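/- Let $n\ge 2$, let $\alpha$ be a germ at a point $x_0$ of a $C^6$-smooth hypersurface in Euclidean space $\mathbb R^n$ with positive definite second fundamental form (with respect to its exterior unit normal field $\vec n$), and let $\Pi\ni x_0$ be a two-dimensional affine plane transversal to $\alpha$. Set $\beta=\Pi\cap\alpha$, a germ at $x_0$ of planar curve. For a point $O\in\beta$ let $L\subset\Pi$ be the line tangent to $\beta$ at $O$, and let $\mathcal L$ be the class of lines parallel to $L$. Let $\mathcal R_{\alpha,\mathcal L}$ be the germ at $\vec n(O)$ of the involution of the unit sphere $S^{n-1}$ defined by $\mathcal R_{\alpha,\mathcal L}(\vec n(A))=\vec n(B)$ whenever $A,B\in\alpha$ are the two points, close to $O$, of intersection of $\alpha$ with a line $\Lambda\in\mathcal L$ (with $A=B$ if $\Lambda$ is tangent to $\alpha$). Suppose that for every point $O\in\beta$ (sufficiently close to $x_0$) the germ $\mathcal R_{\alpha,\mathcal L}$ at $\vec n(O)$ is a lifting to $S^{n-1}$, under the tautological projection $S^{n-1}\to\mathbb{RP}^{n-1}$, of (the germ of) a projective transformation of $\mathbb{RP}^{n-1}$. Then $\beta$ is a conic: near $x_0$ it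 coincides with a regular real conic (an ellipse, a parabola or a hyperbola) in $\Pi$. In particular, every point $O\in\beta$ sufficiently close to $x_0$ is sextactic: there is a regular conic in $\Pi$ (the osculating conic of $\beta$ at $O$) having contact of order greater than five with $\beta$ at $O$, that is, having the same $5$-jet as $\beta$ at $O$. -/

import Mathlib

open Filter Topology

noncomputable section

/-- Euclidean space `ℝⁿ`. -/
abbrev Euc (n : ℕ) : Type := EuclideanSpace ℝ (Fin n)

/-- A representative of a germ at `x₀` of a co-oriented `C⁶`-smooth hypersurface in `ℝⁿ`:
near `x₀` the set `carrier` is the zero set of a `C⁶` function `eqn` without critical points.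
The co-orientation (the choice of the exterior side) is the direction of the gradient of `eqn`.
Only the behaviour of `carrier` and `eqn` near `x₀` matters. -/
structure HypersurfaceGerm (n : ℕ) (x₀ : Euc n) where
  carrier : Set (Euc n)
  eqn : Euc n → ℝ
  contDiffAt : ContDiffAt ℝ 6 eqn x₀
  gradient_ne_zero : gradient eqn x₀ ≠ 0
  base_mem : x₀ ∈ carrier
  mem_iff : ∀ᶠ x in 𝓝 x₀, x ∈ carrier ↔ eqn x = 0

namespace HypersurfaceGerm

variable {n : ℕ} {x₀ : Euc n} (α : HypersurfaceGerm n x₀)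

/-- The tangent hyperplane (as a vector subspace) at a point `p` of the hypersurface. -/
def tangent (p : Euc n) : Submodule ℝ (Euc n) :=
  LinearMap.ker (fderiv ℝ α.eqn p : Euc n →ₗ[ℝ] ℝ)

/-- The exterior unit normal vector. -/
def normal (p : Euc n) : Euc n := ‖gradient α.eqn p‖⁻¹ • gradient α.eqn p

/-- The second fundamental form `⟨dn(u), w⟩` with respect to the exterior unit normal field `n`,
to be evaluated on tangent vectors `u`, `w` at `p`; it is positive for the unit sphere with the
outward normal. -/
def secondForm (p u w : Euc n) : ℝ := inner ℝ (fderiv ℝ α.normal p u) w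

/-- The second fundamental form is positive definite at the base point (hence also nearby). -/
def PosDefSecondForm : Prop :=
  ∀ u ∈ α.tangent x₀, u ≠ 0 → 0 < α.secondForm x₀ u u

/-- The plane `P` passes through the base point and is transversal there to the hypersurface. -/
def TransversalTo (P : AffineSubspace ℝ (Euc n)) : Prop :=
  x₀ ∈ P ∧ α.tangent x₀ ⊔ P.direction = ⊤

/-- The section of the hypersurface by `P`. -/
def planeSection (P : AffineSubspace ℝ (Euc n)) : Set (Euc n) := α.carrier ∩ P

/-- `L` is a line in `P` tangent at `O` to the section by `P`. -/
def IsSectionTangentLine (P L : AffineSubspace ℝ (Euc n)) (O : Euc n) : Prop :=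
  Module.finrank ℝ L.direction = 1 ∧ O ∈ L ∧ L ≤ P ∧ L.direction ≤ α.tangent O

/-- `A` and `B` are the two intersection points of the hypersurface with a line `Λ` parallel
to `L`; the points coincide exactly when `Λ` is tangent to the hypersurface. -/
def Paired (L : AffineSubspace ℝ (Euc n)) (A B : Euc n) : Prop :=
  A ∈ α.carrier ∧ B ∈ α.carrier ∧
    ∃ Λ : AffineSubspace ℝ (Euc n), Λ.Parallel L ∧ A ∈ Λ ∧ B ∈ Λ ∧
      (A = B → Λ.direction ≤ α.tangent A)

/-- The germ of `f` at the unit normal at `O` is the germ of the involution of the unit sphere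
defined by the class of lines parallel to `L`: it sends `n(A)` to `n(B)` whenever `A`, `B` are
the points of intersection, close to `O`, of the hypersurface with a line parallel to `L`. -/
def IsReflection (L : AffineSubspace ℝ (Euc n)) (O : Euc n)
    (f : Metric.sphere (0 : Euc n) 1 → Metric.sphere (0 : Euc n) 1) : Prop :=
  ∃ U ∈ 𝓝 O, ∀ A ∈ U, ∀ B ∈ U, α.Paired L A B →
    ∀ ν : Metric.sphere (0 : Euc n) 1, (ν : Euc n) = α.normal A → (f ν : Euc n) = α.normal B

end HypersurfaceGerm

/-- The tautological projection of the unit sphere to the projective space. -/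
def toRP {n : ℕ} (ν : Metric.sphere (0 : Euc n) 1) : Projectivization ℝ (Euc n) :=
  Projectivization.mk ℝ (ν : Euc n) (ne_zero_of_mem_unit_sphere ν)

/-- The germ of `f` at `ν₀` is a lifting to the sphere of a projective transformation. -/
def IsProjectiveLiftAt {n : ℕ}
    (f : Metric.sphere (0 : Euc n) 1 → Metric.sphere (0 : Euc n) 1)
    (ν₀ : Metric.sphere (0 : Euc n) 1) : Prop :=
  ∃ g : Euc n ≃ₗ[ℝ] Euc n, ∀ᶠ ν in 𝓝 ν₀,
    toRP (f ν) = Projectivization.map (g : Euc n →ₗ[ℝ] Euc n) g.injective (toRP ν)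

/-- The germ at `n(O)` of the involution defined by `α` and the class of lines parallel to `L`
is a lifting to the sphere of a projective transformation. -/
def HypersurfaceGerm.ReflectionIsProjective {n : ℕ} {x₀ : Euc n} (α : HypersurfaceGerm n x₀)
    (L : AffineSubspace ℝ (Euc n)) (O : Euc n) : Prop :=
  ∃ f : Metric.sphere (0 : Euc n) 1 → Metric.sphere (0 : Euc n) 1,
    α.IsReflection L O f ∧
      ∀ ν₀ : Metric.sphere (0 : Euc n) 1, (ν₀ : Euc n) = α.normal O → IsProjectiveLiftAt f ν₀

/-- `C` is a regular real conic (an ellipse, a parabola or a hyperbola) in the plane `P`: in some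
affine coordinates `(s, t)` on `P` it is a nonempty set given by a quadratic equation
`(s, t, 1) Q (s, t, 1)ᵀ = 0` with a nondegenerate symmetric matrix `Q`. -/
def IsConicIn {n : ℕ} (P : AffineSubspace ℝ (Euc n)) (C : Set (Euc n)) : Prop :=
  C.Nonempty ∧
    ∃ p ∈ P, ∃ u ∈ P.direction, ∃ w ∈ P.direction, LinearIndependent ℝ ![u, w] ∧
      ∃ Q : Matrix (Fin 3) (Fin 3) ℝ, Q.IsSymm ∧ Q.det ≠ 0 ∧
        C = {x | ∃ s t : ℝ, x = p + s • u + t • w ∧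
          ![s, t, 1] ⬝ᵥ Q.mulVec ![s, t, 1] = 0}

/-- The curves `β` and `C` have contact of order greater than `k` at `O`: they have regular local
parametrizations at `O` with the same `k`-jet. -/
def HasContactGT {n : ℕ} (k : ℕ) (β C : Set (Euc n)) (O : Euc n) : Prop :=
  ∃ γ δ : ℝ → Euc n, ContDiffAt ℝ k γ 0 ∧ ContDiffAt ℝ k δ 0 ∧ γ 0 = O ∧ δ 0 = O ∧
    deriv γ 0 ≠ 0 ∧ deriv δ 0 ≠ 0 ∧ (∀ᶠ t in 𝓝 0, γ t ∈ β ∧ δ t ∈ C) ∧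
    (fun t => γ t - δ t) =o[𝓝 0] (fun t : ℝ => t ^ k)

/-- `C` is an osculating conic of the curve `β ⊆ P` at `O`: a conic with the same `4`-jet. -/
def IsOsculatingConic {n : ℕ} (P : AffineSubspace ℝ (Euc n)) (β C : Set (Euc n))
    (O : Euc n) : Prop :=
  IsConicIn P C ∧ HasContactGT 4 β C O

/-- `O` is a sextactic point of the curve `β ⊆ P`: the osculating conic at `O` has contact of
order greater than five with `β`. -/
def IsSextactic {n : ℕ} (P : AffineSubspace ℝ (Euc n)) (β : Set (Euc n)) (O : Euc n) : Prop :=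
  ∃ C : Set (Euc n), IsOsculatingConic P β C O ∧ HasContactGT 5 β C O

end

/-! The projectivity hypothesis turns into a statement about planar chords, and that statement
forces Monge's equation.

Let `e` direct the tangent line at `O`, and let `g` be the linear map behind the reflection. A point
where a line parallel to `e` touches the hypersurface is paired with itself, so its normal spans a
line fixed by `g`. By strict convexity (`eventually_gauss_open`) such normals fill, up to scaling, a
neighbourhood of the normal at `O` in the hyperplane `e^⊥`. Hence `g` is a scalar `c` on `e^⊥`, and
`g ξ = c ξ + ⟨ξ, e⟩ w` everywhere. The ratio `⟨ξ, v⟩ / ⟨ξ, e⟩` is then transformed by an affine map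
of one variable (`eventually_normal_ratio`).

Write the section as the graph of `φ`. Its tangent vectors are orthogonal to the normals, so at
abscissa `x` this ratio is `-1 / (φ' x - φ' c)`, where `c` now denotes the abscissa of `O`.
Exchanging the endpoints of a chord shows that the affine map has slope `-1`: the reciprocals of the
relative slopes at the two ends have a constant sum. Integrated, this says that the midpoints of the
chords parallel to the tangent line lie on a line, so the curve is locally invariant under an affine
reflection fixing `O` (`eventually_apply_reflection_eq`).

The affine curvature is, up to a constant factor, `(φ''^(-2/3))''`. It is invariant under this
reflection, which reverses the curve at `O`, so its derivative vanishes there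
(`affineCurvature_deriv_eq_zero`). As `O` is arbitrary, `φ''^(-2/3)` is a quadratic polynomial, and
integrating twice gives a conic (`exists_quadratic_relation`). This one conic has contact of the
required order at every nearby point. -/

/-! ### Differentiating and integrating local identities. -/

/-- Points to the left of `c` are interior to the half-line, so a one-sided identity can still be
differentiated. The reflection identity is known only on this side. -/
theorem hasDerivAt_eq_of_eventuallyEq_left {c : ℝ} {f g f' g' : ℝ → ℝ} (h : f =ᶠ[𝓝[<] c] g)
    (hf : ∀ᶠ x in 𝓝[<] c, HasDerivAt f (f' x) x) (hg : ∀ᶠ x in 𝓝[<] c, HasDerivAt g (g' x) x) :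
    f' =ᶠ[𝓝[<] c] g' := by
  have h' := eventually_eventually_nhdsWithin.2 h
  filter_upwards [h', hf, hg, self_mem_nhdsWithin] with x hx hfx hgx hxc
  rw [IsOpen.nhdsWithin_eq isOpen_Iio hxc] at hx
  exact hfx.unique (hgx.congr_of_eventuallyEq hx)

theorem eventuallyEq_of_hasDerivAt_eq {c : ℝ} {f g f' : ℝ → ℝ}
    (hf : ∀ᶠ x in 𝓝 c, HasDerivAt f (f' x) x) (hg : ∀ᶠ x in 𝓝 c, HasDerivAt g (f' x) x)
    (hc : f c = g c) : f =ᶠ[𝓝 c] g := by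
  obtain ⟨r, hr, h⟩ := Metric.eventually_nhds_iff_ball.1 (hf.and hg)
  filter_upwards [Metric.ball_mem_nhds c hr] with x hx
  have hd : ∀ y ∈ Metric.ball c r, HasDerivAt (fun z => f z - g z) 0 y := fun y hy => by
    have := (h y hy).1.sub (h y hy).2
    rwa [sub_self] at this
  have := IsOpen.is_const_of_deriv_eq_zero (f := fun z => f z - g z) Metric.isOpen_ball
    (convex_ball c r).isPreconnected
    (fun y hy => (hd y hy).differentiableAt.differentiableWithinAt)
    (fun y hy => (hd y hy).deriv) hx (Metric.mem_ball_self hr)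
  simp only [hc, sub_self] at this
  linarith

/-! ### Affine reflections and affine curvature of planar curves. -/

/-- If the reciprocals of the slopes at the two endpoints of every short horizontal chord of the
graph of a convex function have a constant sum, then the graph is locally invariant under an
affine reflection. -/
theorem eventually_apply_reflection_eq {c b : ℝ} {ψ ψ₁ ψ₂ : ℝ → ℝ}
    (h : ∀ᶠ x in 𝓝 c, HasDerivAt ψ (ψ₁ x) x) (h₁ : ∀ᶠ x in 𝓝 c, HasDerivAt ψ₁ (ψ₂ x) x)
    (hpos : ∀ᶠ x in 𝓝 c, 0 < ψ₂ x) (hψ : ψ c = 0) (hψ₁ : ψ₁ c = 0)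
    (hb : ∃ U ∈ 𝓝 c, ∀ x ∈ U, ∀ y ∈ U, x ≠ y → ψ x = ψ y → ψ₁ x ≠ 0 → ψ₁ y ≠ 0 →
      (ψ₁ x)⁻¹ + (ψ₁ y)⁻¹ = b) :
    ∀ᶠ x in 𝓝[<] c, ψ (b * ψ x - x + 2 * c) = ψ x := by
  obtain ⟨U, hU, hUb⟩ := hb
  obtain ⟨r, hr, H⟩ := Metric.eventually_nhds_iff_ball.1 (h.and (h₁.and (hpos.and hU)))
  simp only [Real.ball_eq_Ioo] at H
  have hcr : c ∈ Set.Ioo (c - r) (c + r) := by constructor <;> linarith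
  have hmono : StrictMonoOn ψ₁ (Set.Ioo (c - r) (c + r)) := by
    refine strictMonoOn_of_hasDerivWithinAt_pos (f' := ψ₂) (convex_Ioo _ _)
      (fun x hx => (H x hx).2.1.continuousAt.continuousWithinAt) (fun x hx => ?_) (fun x hx => ?_)
    · rw [interior_Ioo] at hx
      exact (H x hx).2.1.hasDerivWithinAt
    · rw [interior_Ioo] at hx
      exact (H x hx).2.2.1
  have hneg : ∀ x ∈ Set.Ioo (c - r) c, ψ₁ x < 0 := fun x hx => by
    have := hmono ⟨hx.1, hx.2.trans hcr.2⟩ hcr hx.2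
    rwa [hψ₁] at this
  have hpo : ∀ x ∈ Set.Ioo c (c + r), 0 < ψ₁ x := fun x hx => by
    have := hmono hcr ⟨hcr.1.trans hx.1, hx.2⟩ hx.1
    rwa [hψ₁] at this
  have hR : StrictMonoOn ψ (Set.Ico c (c + r)) := by
    refine strictMonoOn_of_hasDerivWithinAt_pos (f' := ψ₁) (convex_Ico _ _)
      (fun x hx => (H x ⟨hcr.1.trans_le hx.1, hx.2⟩).1.continuousAt.continuousWithinAt)
      (fun x hx => ?_) (fun x hx => ?_)
    · rw [interior_Ico] at hx
      exact (H x ⟨hcr.1.trans hx.1, hx.2⟩).1.hasDerivWithinAt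
    · rw [interior_Ico] at hx
      exact hpo x hx
  have hL : StrictAntiOn ψ (Set.Ioc (c - r) c) := by
    refine strictAntiOn_of_hasDerivWithinAt_neg (f' := ψ₁) (convex_Ioc _ _)
      (fun x hx => (H x ⟨hx.1, hx.2.trans_lt hcr.2⟩).1.continuousAt.continuousWithinAt)
      (fun x hx => ?_) (fun x hx => ?_)
    · rw [interior_Ioc] at hx
      exact (H x ⟨hx.1, hx.2.trans hcr.2⟩).1.hasDerivWithinAt
    · rw [interior_Ioc] at hx
      exact hneg x hx
  have hcont : ContinuousAt ψ c := (H c hcr).1.continuousAt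
  have hsmall : ∀ d ∈ Set.Ioo c (c + r), ∀ᶠ x in 𝓝 c, ψ x < ψ d := fun d hd => by
    have : ψ c < ψ d := hR ⟨le_rfl, hcr.2⟩ ⟨hd.1.le, hd.2⟩ hd.1
    exact hcont.eventually (gt_mem_nhds this)
  set d := c + r / 2 with hd
  have hdm : d ∈ Set.Ioo c (c + r) := by constructor <;> simp only [hd] <;> linarith
  obtain ⟨r', hr', H'⟩ := Metric.eventually_nhds_iff_ball.1
    ((hsmall d hdm).and (isOpen_Ioo.mem_nhds hcr))
  simp only [Real.ball_eq_Ioo] at H'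
  -- The number `τ x` is the right endpoint of the horizontal chord whose left endpoint has abscissa
  -- `x`.
  have hτ : ∀ x, x ∈ Set.Ioo (c - r') c → ∃ t ∈ Set.Ioo c d, ψ t = ψ x := fun x hx => by
    have hx' := H' x ⟨hx.1, by linarith [hx.2]⟩
    have h0 : 0 < ψ x := by
      have := hL (a := x) (b := c) ⟨hx'.2.1, hx.2.le⟩ ⟨hcr.1, le_rfl⟩ hx.2
      rwa [hψ] at this
    have hcontd : ContinuousOn ψ (Set.Icc c d) := fun y hy =>
      (H y ⟨hcr.1.trans_le hy.1, hy.2.trans_lt hdm.2⟩).1.continuousAt.continuousWithinAt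
    obtain ⟨t, ht, hte⟩ := intermediate_value_Ioo hdm.1.le hcontd
      ⟨by rw [hψ]; exact h0, hx'.1⟩
    exact ⟨t, ht, hte⟩
  choose! τ hτm hτe using hτ
  -- Since `τ' = ψ₁ x / ψ₁ (τ x)`, multiplying the hypothesis on reciprocals by `ψ₁ x` gives `1 + τ'
  -- = b ψ₁`.
  have hdr : ∀ x ∈ Set.Ioo (c - r') c, HasDerivAt (fun x => x + τ x - b * ψ x) 0 x := by
    intro x hx
    have hxr : x ∈ Set.Ioo (c - r) (c + r) := (H' x ⟨hx.1, by linarith [hx.2]⟩).2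
    have htr : τ x ∈ Set.Ioo (c - r) (c + r) :=
      ⟨hcr.1.trans (hτm x hx).1, (hτm x hx).2.trans hdm.2⟩
    have htpos : 0 < ψ₁ (τ x) := hpo _ ⟨(hτm x hx).1, htr.2⟩
    have hxneg : ψ₁ x < 0 := hneg _ ⟨hxr.1, hx.2⟩
    have hst : HasStrictDerivAt ψ (ψ₁ (τ x)) (τ x) := by
      refine hasStrictDerivAt_of_hasDerivAt_of_continuousAt ?_ (H _ htr).2.1.continuousAt
      filter_upwards [isOpen_Ioo.mem_nhds htr] with y hy using (H y hy).1
    have hg := hst.to_localInverse htpos.ne'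
    have hgr := hst.eventually_right_inverse htpos.ne'
    have hgl := (hst.eventually_left_inverse htpos.ne').self_of_nhds
    set g := hst.localInverse ψ (ψ₁ (τ x)) (τ x) htpos.ne'
    rw [hτe x hx] at hg hgr hgl
    have hcx : ContinuousAt ψ x := (H x hxr).1.continuousAt
    -- Since `τ` comes from a choice, its differentiability is obtained by identifying it with a
    -- local inverse of `ψ` composed with `ψ`, using injectivity on the right branch.
    have hτg : τ =ᶠ[𝓝 x] fun y => g (ψ y) := by
      have hgc : Tendsto (fun y => g (ψ y)) (𝓝 x) (𝓝 (τ x)) := by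
        have := hg.hasDerivAt.continuousAt.comp hcx
        rw [ContinuousAt, Function.comp_apply, hgl] at this
        exact this
      filter_upwards [isOpen_Ioo.mem_nhds hx, hcx.eventually hgr,
        hgc.eventually (isOpen_Ioo.mem_nhds (hτm x hx))] with y hy hgy hgm
      refine hR.injOn ⟨(hτm y hy).1.le, (hτm y hy).2.trans hdm.2⟩
        ⟨hgm.1.le, hgm.2.trans hdm.2⟩ ?_
      rw [hτe y hy, hgy]
    have hdτ : HasDerivAt τ ((ψ₁ (τ x))⁻¹ * ψ₁ x) x :=
      (hg.hasDerivAt.comp x (H x hxr).1).congr_of_eventuallyEq hτg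
    have := ((hasDerivAt_id x).add hdτ).sub ((H x hxr).1.const_mul b)
    convert! this using 1
    have hb' := hUb x (H x hxr).2.2.2 (τ x) (H _ htr).2.2.2
      (by have := (hτm x hx).1; have := hx.2; intro h; linarith) (hτe x hx).symm hxneg.ne htpos.ne'
    rw [← hb', add_mul, inv_mul_cancel₀ hxneg.ne]
    ring
  have hτlim : Tendsto τ (𝓝[<] c) (𝓝 c) := by
    have hmem : ∀ᶠ x in 𝓝[<] c, x ∈ Set.Ioo (c - r') c :=
      Ioo_mem_nhdsLT (by linarith)
    refine tendsto_order.2 ⟨fun a ha => ?_, fun a ha => ?_⟩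
    · filter_upwards [hmem] with x hx using ha.trans (hτm x hx).1
    · have hm : min a d ∈ Set.Ioo c (c + r) := ⟨lt_min ha hdm.1, (min_le_right _ _).trans_lt hdm.2⟩
      filter_upwards [hmem, (hsmall _ hm).filter_mono nhdsWithin_le_nhds] with x hx hx2
      rw [← hτe x hx] at hx2
      have := (hR.lt_iff_lt ⟨(hτm x hx).1.le, (hτm x hx).2.trans hdm.2⟩ ⟨hm.1.le, hm.2⟩).1 hx2
      exact this.trans_le (min_le_left _ _)
  -- The constant of integration is the limit as the chord shrinks to `c`, namely `2 * c`.
  have hKlim : Tendsto (fun x => x + τ x - b * ψ x) (𝓝[<] c) (𝓝 (c + c - b * 0)) := by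
    refine ((tendsto_nhdsWithin_of_tendsto_nhds tendsto_id).add hτlim).sub
      (Tendsto.const_mul b ?_)
    have := hcont.tendsto
    rw [hψ] at this
    exact tendsto_nhdsWithin_of_tendsto_nhds this
  have hmem : ∀ᶠ x in 𝓝[<] c, x ∈ Set.Ioo (c - r') c := Ioo_mem_nhdsLT (by linarith)
  filter_upwards [hmem] with x hx
  have hconst : ∀ᶠ y in 𝓝[<] c, y + τ y - b * ψ y = x + τ x - b * ψ x := by
    filter_upwards [hmem] with y hy
    exact IsOpen.is_const_of_deriv_eq_zero (f := fun z => z + τ z - b * ψ z) isOpen_Ioo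
      isPreconnected_Ioo (fun y hy => (hdr y hy).differentiableAt.differentiableWithinAt)
      (fun y hy => (hdr y hy).deriv) hy hx
  have hK : x + τ x - b * ψ x = c + c - b * 0 :=
    tendsto_nhds_unique (tendsto_const_nhds.congr' (hconst.mono fun _ h => h.symm)) hKlim
  rw [← hτe x hx]
  congr 1
  rw [hτe x hx]
  linarith

/-- A function whose graph is locally invariant under an affine reflection: the derivative of
its affine curvature vanishes at the fixed point. -/
theorem affineCurvature_deriv_eq_zero {c b Q₃ : ℝ} {ψ ψ₁ ψ₂ ψ₃ Q Q₁ Q₂ : ℝ → ℝ}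
    (h : ∀ᶠ x in 𝓝 c, HasDerivAt ψ (ψ₁ x) x) (h₁ : ∀ᶠ x in 𝓝 c, HasDerivAt ψ₁ (ψ₂ x) x)
    (h₂ : ∀ᶠ x in 𝓝 c, HasDerivAt ψ₂ (ψ₃ x) x)
    (hpos : ∀ᶠ x in 𝓝 c, 0 < ψ₂ x) (hψ : ψ c = 0) (hψ₁ : ψ₁ c = 0)
    (hQ : ∀ᶠ x in 𝓝 c, Q x = ψ₂ x ^ (-2 / 3 : ℝ))
    (hQ₁ : ∀ᶠ x in 𝓝 c, HasDerivAt Q (Q₁ x) x) (hQ₂ : ∀ᶠ x in 𝓝 c, HasDerivAt Q₁ (Q₂ x) x)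
    (hQ₃ : HasDerivAt Q₂ Q₃ c)
    (hrefl : ∀ᶠ x in 𝓝[<] c, ψ (b * ψ x - x + 2 * c) = ψ x) : Q₃ = 0 := by
  set σ : ℝ → ℝ := fun x => b * ψ x - x + 2 * c with hσ
  have hσ' : ∀ᶠ x in 𝓝 c, HasDerivAt σ (b * ψ₁ x - 1) x := by
    filter_upwards [h] with x hx
    exact ((hx.const_mul b).sub (hasDerivAt_id x)).add_const _
  have hσc : σ c = c := by simp [hσ, hψ]; ring
  have hσt : Tendsto σ (𝓝 c) (𝓝 c) := by
    have := hσ'.self_of_nhds.continuousAt.tendsto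
    rwa [hσc] at this
  -- This is the logarithmic derivative of `Q = ψ₂ ^ (-2/3)`; it cancels the extra terms in `e7`.
  have hQd : ∀ᶠ x in 𝓝 c, 3 * Q₁ x * ψ₂ x + 2 * Q x * ψ₃ x = 0 := by
    filter_upwards [eventually_eventually_nhds.2 hQ, hQ₁, h₂, hpos] with x hx hx1 hx2 hx3
    have e := (hx2.rpow_const (p := -2 / 3) (Or.inl hx3.ne')).congr_of_eventuallyEq hx
    have e2 := hx1.unique e
    rw [e2, hx.self_of_nhds, Real.rpow_sub_one hx3.ne']
    field_simp
    ring
  have hl : ∀ {p : ℝ → Prop}, (∀ᶠ x in 𝓝 c, p x) → ∀ᶠ x in 𝓝[<] c, p x :=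
    fun hp => hp.filter_mono nhdsWithin_le_nhds
  have hneg : ∀ᶠ x in 𝓝 c, b * ψ₁ x - 1 < 0 := by
    have : ContinuousAt (fun x => b * ψ₁ x - 1) c :=
      (h₁.self_of_nhds.continuousAt.const_mul b).sub continuousAt_const
    exact this.eventually (gt_mem_nhds (by simp [hψ₁]))
  have e1 : (fun x => ψ₁ (σ x) * (b * ψ₁ x - 1)) =ᶠ[𝓝[<] c] ψ₁ := by
    refine hasDerivAt_eq_of_eventuallyEq_left (f := fun x => ψ (σ x)) hrefl ?_ (hl h)
    filter_upwards [hl (hσt.eventually h), hl hσ'] with x hx hx' using hx.comp x hx'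
  have e2 := hasDerivAt_eq_of_eventuallyEq_left e1
    (f' := fun x => ψ₂ (σ x) * (b * ψ₁ x - 1) * (b * ψ₁ x - 1) + ψ₁ (σ x) * (b * ψ₂ x)) (by
      filter_upwards [hl (hσt.eventually h₁), hl hσ', hl h₁] with x hx hx' hx1
      exact (hx.comp x hx').mul ((hx1.const_mul b).sub_const 1)) (hl h₁)
  -- Combining the first two derivatives of `ψ ∘ σ = ψ` yields `ψ₂ (σ x) (-σ')³ = ψ₂ x`. The power
  -- `-2/3` turns the cube into the square `σ'²`.
  have e3 : (fun x => Q (σ x)) =ᶠ[𝓝[<] c] fun x => Q x * (b * ψ₁ x - 1) ^ 2 := by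
    filter_upwards [e1, e2, hl hneg, hl hQ, hl (hσt.eventually hQ), hl hpos,
      hl (hσt.eventually hpos)] with x e1 e2 hn hQx hQs hp hps
    have e4 : ψ₂ (σ x) * (1 - b * ψ₁ x) ^ 3 = ψ₂ x := by
      have := congrArg (· * (b * ψ₁ x - 1)) e2
      linear_combination (-1) * this + (b * ψ₂ x) * e1
    have hn' : 0 < 1 - b * ψ₁ x := by linarith
    rw [hQx, hQs, ← e4, Real.mul_rpow hps.le (by positivity), ← Real.rpow_natCast _ 3,
      ← Real.rpow_mul hn'.le, mul_assoc]
    have : (1 - b * ψ₁ x) ^ (((3 : ℕ) : ℝ) * (-2 / 3)) * (b * ψ₁ x - 1) ^ 2 = 1 := by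
      have h2 : (((3 : ℕ) : ℝ) * (-2 / 3)) = -((2 : ℕ) : ℝ) := by norm_num
      rw [h2, Real.rpow_neg hn'.le, Real.rpow_natCast]
      have : (b * ψ₁ x - 1) ^ 2 = (1 - b * ψ₁ x) ^ 2 := by ring
      rw [this, inv_mul_cancel₀ (by positivity)]
    rw [this, mul_one]
  have e4 := hasDerivAt_eq_of_eventuallyEq_left e3
    (f' := fun x => Q₁ (σ x) * (b * ψ₁ x - 1))
    (g' := fun x => Q₁ x * (b * ψ₁ x - 1) ^ 2 +
      Q x * (2 * (b * ψ₁ x - 1) ^ 1 * (b * ψ₂ x))) (by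
      filter_upwards [hl (hσt.eventually hQ₁), hl hσ'] with x hx hx'
      exact hx.comp x hx') (by
      filter_upwards [hl hQ₁, hl h₁] with x hx hx1
      exact hx.mul (((hx1.const_mul b).sub_const 1).pow 2))
  have e5 : (fun x => Q₁ (σ x)) =ᶠ[𝓝[<] c] fun x =>
      Q₁ x * (b * ψ₁ x - 1) + 2 * (Q x * (b * ψ₂ x)) := by
    filter_upwards [e4, hl hneg] with x e4 hn
    refine mul_right_cancel₀ hn.ne ?_
    linear_combination e4
  have e6 := hasDerivAt_eq_of_eventuallyEq_left e5
    (f' := fun x => Q₂ (σ x) * (b * ψ₁ x - 1))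
    (g' := fun x => (Q₂ x * (b * ψ₁ x - 1) + Q₁ x * (b * ψ₂ x)) +
      2 * (Q₁ x * (b * ψ₂ x) + Q x * (b * ψ₃ x))) (by
      filter_upwards [hl (hσt.eventually hQ₂), hl hσ'] with x hx hx'
      exact hx.comp x hx') (by
      filter_upwards [hl hQ₁, hl h₁, hl hQ₂, hl h₂] with x hx hx1 hx2 hx3
      exact (hx2.mul ((hx1.const_mul b).sub_const 1)).add
        ((hx.mul (hx3.const_mul b)).const_mul 2))
  have e7 : (fun x => Q₂ (σ x)) =ᶠ[𝓝[<] c] Q₂ := by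
    filter_upwards [e6, hl hneg, hl hQd] with x e6 hn hd
    refine mul_right_cancel₀ hn.ne ?_
    linear_combination e6 + b * hd
  -- Here `σ' c = -1`, so comparing left derivatives in `Q₂ ∘ σ = Q₂` gives `-Q₃ = Q₃`.
  have hd1 : HasDerivAt (fun x => Q₂ (σ x)) (Q₃ * (b * ψ₁ c - 1)) c := by
    have h3 : HasDerivAt Q₂ Q₃ (σ c) := by rwa [hσc]
    exact h3.comp c hσ'.self_of_nhds
  have hd2 := (hQ₃.hasDerivWithinAt (s := Set.Iio c)).congr_of_eventuallyEq e7 (by rw [hσc])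
  have := (uniqueDiffWithinAt_Iio c).eq_deriv _ hd1.hasDerivWithinAt hd2
  rw [hψ₁] at this
  linarith

/-! ### Integration of Monge's equation. -/

/-- A solution of Monge's differential equation of conics satisfies a quadratic equation. -/
theorem exists_quadratic_relation {φ φ₁ φ₂ Q Q₁ Q₂ : ℝ → ℝ}
    (h : ∀ᶠ x in 𝓝 0, HasDerivAt φ (φ₁ x) x) (h₁ : ∀ᶠ x in 𝓝 0, HasDerivAt φ₁ (φ₂ x) x)
    (hpos : ∀ᶠ x in 𝓝 0, 0 < φ₂ x) (hφ : φ 0 = 0) (hφ₁ : φ₁ 0 = 0)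
    (hQ : ∀ᶠ x in 𝓝 0, Q x = φ₂ x ^ (-2 / 3 : ℝ))
    (hQ₁ : ∀ᶠ x in 𝓝 0, HasDerivAt Q (Q₁ x) x) (hQ₂ : ∀ᶠ x in 𝓝 0, HasDerivAt Q₁ (Q₂ x) x)
    (hQ₃ : ∀ᶠ x in 𝓝 0, HasDerivAt Q₂ 0 x) :
    ∃ p q r : ℝ, p ≠ 0 ∧
      ∀ᶠ s in 𝓝 0, p * s ^ 2 + 2 * q * s * φ s + r * φ s ^ 2 - 2 * φ s = 0 := by
  set A := Q 0 with hA
  set B := Q₁ 0 with hB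
  set C := Q₂ 0 / 2 with hC
  set p := φ₂ 0 with hp
  have hp0 : 0 < p := hpos.self_of_nhds
  have hAp : A = p ^ (-2 / 3 : ℝ) := hQ.self_of_nhds
  have hA0 : 0 < A := by rw [hAp]; positivity
  have hQ2 : Q₂ =ᶠ[𝓝 0] fun _ => 2 * C :=
    eventuallyEq_of_hasDerivAt_eq hQ₃ (.of_forall fun x => hasDerivAt_const x _)
      (by simp only [hC]; ring)
  have hQ1 : Q₁ =ᶠ[𝓝 0] fun x => B + 2 * C * x := by
    refine eventuallyEq_of_hasDerivAt_eq hQ₂ ?_ (by simp [hB])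
    filter_upwards [hQ2] with x hx
    rw [hx]
    simpa using ((hasDerivAt_id x).const_mul (2 * C)).const_add B
  have hQ0 : Q =ᶠ[𝓝 0] fun x => A + B * x + C * x ^ 2 := by
    refine eventuallyEq_of_hasDerivAt_eq hQ₁ ?_ (by simp [hA])
    filter_upwards [hQ1] with x hx
    rw [hx]
    convert! (((hasDerivAt_id x).const_mul B).const_add A).add (((hasDerivAt_id x).pow 2).const_mul C)
      using 1
    simp
    ring
  -- The coefficients are chosen so that `Q = A * R`, where `R s = (1 - q s)² - p r s²` is a quarter
  -- of the discriminant, in `φ`, of the desired quadratic equation.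
  set q := -B / (2 * A) with hq
  set r := (q ^ 2 - C / A) / p with hr
  set R : ℝ → ℝ := fun s => 1 - 2 * q * s + (q ^ 2 - p * r) * s ^ 2 with hR
  have hQR : ∀ᶠ x in 𝓝 0, Q x = A * R x := by
    filter_upwards [hQ0] with x hx
    rw [hx]
    simp only [hR, hr, hq]
    field_simp
    ring
  have hRd : ∀ x, HasDerivAt R (-2 * q + (q ^ 2 - p * r) * (2 * x)) x := fun x => by
    have := (((hasDerivAt_id x).const_mul (2 * q)).const_sub 1).add
      (((hasDerivAt_id x).pow 2).const_mul (q ^ 2 - p * r))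
    convert! this using 1
    simp
  have hRpos : ∀ᶠ x in 𝓝 0, 0 < R x :=
    (hRd 0).continuousAt.eventually (lt_mem_nhds (by simp [hR]))
  set S : ℝ → ℝ := fun x => √(R x) with hS
  have hφS : ∀ᶠ x in 𝓝 0, φ₂ x = p / S x ^ 3 := by
    filter_upwards [hQR, hQ, hpos, hRpos] with x hx hx1 hx2 hx3
    have e : φ₂ x = (Q x) ^ (-3 / 2 : ℝ) := by
      rw [hx1, ← Real.rpow_mul hx2.le]
      norm_num
    have e2 : p = A ^ (-3 / 2 : ℝ) := by
      rw [hAp, ← Real.rpow_mul hp0.le]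
      norm_num
    have e3 : R x ^ (-3 / 2 : ℝ) = (S x ^ 3)⁻¹ := by
      rw [hS]
      simp only
      rw [Real.sqrt_eq_rpow, ← Real.rpow_natCast, ← Real.rpow_mul hx3.le, ← Real.rpow_neg hx3.le]
      norm_num
    rw [e, hx, Real.mul_rpow hA0.le hx3.le, ← e2, e3]
    rfl
  refine ⟨p, q, r, hp0.ne', ?_⟩
  -- For `r = 0` the equation is linear in `φ` and is solved by a rational function. Otherwise `φ`
  -- is the root `(1 - q s - √R) / r` that vanishes at `0`.
  by_cases hr0 : r = 0
  · have h1q : ∀ᶠ x : ℝ in 𝓝 0, 0 < 1 - q * x := by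
      have : ContinuousAt (fun x : ℝ => 1 - q * x) 0 := by fun_prop
      exact this.eventually (lt_mem_nhds (by simp))
    have hd : ∀ x : ℝ, HasDerivAt (fun x => 1 - q * x) (-q) x := fun x => by
      simpa using ((hasDerivAt_id x).const_mul q).const_sub 1
    have g1 : φ₁ =ᶠ[𝓝 0] fun x => p * (2 * x - q * x ^ 2) / (2 * (1 - q * x) ^ 2) := by
      refine eventuallyEq_of_hasDerivAt_eq h₁ ?_ (by simp [hφ₁])
      filter_upwards [hφS, h1q] with x hx hx1
      have hn : HasDerivAt (fun x : ℝ => p * (2 * x - q * x ^ 2)) (p * (2 - q * (2 * x))) x := by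
        have := (((hasDerivAt_id x).const_mul 2).sub (((hasDerivAt_id x).pow 2).const_mul q)).const_mul p
        convert! this using 1
        simp
      have := hn.div (((hd x).pow 2).const_mul 2) (mul_pos two_pos (pow_pos hx1 2)).ne'
      convert! this using 1
      have hSx : S x = 1 - q * x := by
        simp only [hS, hR, hr0]
        rw [show 1 - 2 * q * x + (q ^ 2 - p * 0) * x ^ 2 = (1 - q * x) ^ 2 by ring]
        exact Real.sqrt_sq hx1.le
      rw [hx, hSx]
      field_simp
      simp
      ring
    have g0 : φ =ᶠ[𝓝 0] fun x => p * x ^ 2 / (2 * (1 - q * x)) := by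
      refine eventuallyEq_of_hasDerivAt_eq h ?_ (by simp [hφ])
      filter_upwards [g1, h1q] with x hx hx1
      have hn : HasDerivAt (fun x : ℝ => p * x ^ 2) (p * (2 * x)) x := by
        have := ((hasDerivAt_id x).pow 2).const_mul p
        convert! this using 1
        simp
      have := hn.div ((hd x).const_mul 2) (mul_pos two_pos hx1).ne'
      convert! this using 1
      rw [hx]
      field_simp
      ring
    filter_upwards [g0, h1q] with x hx hx1
    have h2 : φ x * (2 * (1 - q * x)) = p * x ^ 2 := by
      rw [hx, div_mul_cancel₀ _ (mul_pos two_pos hx1).ne']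
    rw [hr0]
    linear_combination -h2
  · have hSd : ∀ᶠ x in 𝓝 0,
        HasDerivAt S ((-2 * q + (q ^ 2 - p * r) * (2 * x)) / (2 * S x)) x := by
      filter_upwards [hRpos] with x hx using (hRd x).sqrt hx.ne'
    have g1 : φ₁ =ᶠ[𝓝 0] fun x =>
        (-q - (-2 * q + (q ^ 2 - p * r) * (2 * x)) / (2 * S x)) / r := by
      refine eventuallyEq_of_hasDerivAt_eq h₁ ?_ (by simp [hφ₁, hS, hR]; field_simp; simp)
      filter_upwards [hφS, hRpos, hSd] with x hx hx1 hx2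
      have hSx : 0 < S x := Real.sqrt_pos.2 hx1
      have hSq : S x ^ 2 = R x := Real.sq_sqrt hx1.le
      have hn : HasDerivAt (fun x : ℝ => -2 * q + (q ^ 2 - p * r) * (2 * x))
          ((q ^ 2 - p * r) * 2) x := by
        have := (((hasDerivAt_id x).const_mul 2).const_mul (q ^ 2 - p * r)).const_add (-2 * q)
        convert! this using 1
        simp
      have := ((hn.div (hx2.const_mul 2) (by positivity)).const_sub (-q)).div_const r
      convert! this using 1
      rw [hx]
      field_simp
      simp only [hR] at hSq
      rw [hSq]
      ring
    have g0 : φ =ᶠ[𝓝 0] fun x => (1 - q * x - S x) / r := by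
      refine eventuallyEq_of_hasDerivAt_eq h ?_ (by simp [hφ, hS, hR])
      filter_upwards [g1, hSd] with x hx hx1
      rw [hx]
      have := ((((hasDerivAt_id x).const_mul q).const_sub 1).sub hx1).div_const r
      convert! this using 1
      simp
    filter_upwards [g0, hRpos] with x hx hx1
    have hSq : S x ^ 2 = R x := Real.sq_sqrt hx1.le
    rw [hx]
    field_simp
    simp only [hR] at hSq
    linear_combination hSq


/-! ### From the chord condition to a conic. -/

theorem ContDiffAt.deriv_of_add_one {f : ℝ → ℝ} {c : ℝ} (m : ℕ)
    (hf : ContDiffAt ℝ ((m + 1 : ℕ) : WithTop ℕ∞) f c) : ContDiffAt ℝ m (deriv f) c := by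
  have h : ContDiffAt ℝ m (fderiv ℝ f) c := hf.fderiv_right (by norm_cast)
  have : deriv f = fun x => fderiv ℝ f x 1 := by
    ext x
    exact fderiv_apply_one_eq_deriv.symm
  rw [this]
  exact h.clm_apply contDiffAt_const

theorem ContDiffAt.eventually_hasDerivAt {f : ℝ → ℝ} {c : ℝ} (m : ℕ)
    (hf : ContDiffAt ℝ ((m + 1 : ℕ) : WithTop ℕ∞) f c) :
    ∀ᶠ x in 𝓝 c, HasDerivAt f (deriv f x) x := by
  filter_upwards [hf.eventually (by simp)] with x hx
  exact (hx.differentiableAt (by simp)).hasDerivAt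

/-- If for every point of a strictly convex planar curve the involution on slopes induced by the
chords parallel to the tangent line is a projective map, then the curve is a conic. -/
theorem exists_quadratic_relation_of_chords {φ : ℝ → ℝ} (hφ6 : ContDiffAt ℝ 6 φ 0)
    (hφ : φ 0 = 0) (hφ₁ : deriv φ 0 = 0) (hφ₂ : 0 < deriv (deriv φ) 0)
    (hch : ∀ᶠ c in 𝓝 0, ∃ a b : ℝ, ∃ U ∈ 𝓝 c, ∀ x ∈ U, ∀ y ∈ U, x ≠ y →
      φ y - φ x = deriv φ c * (y - x) → deriv φ x ≠ deriv φ c → deriv φ y ≠ deriv φ c →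
      (deriv φ y - deriv φ c)⁻¹ = a * (deriv φ x - deriv φ c)⁻¹ + b) :
    ∃ p q r : ℝ, p ≠ 0 ∧
      ∀ᶠ s in 𝓝 0, p * s ^ 2 + 2 * q * s * φ s + r * φ s ^ 2 - 2 * φ s = 0 := by
  have c5 := ContDiffAt.deriv_of_add_one 5 hφ6
  have c4 := ContDiffAt.deriv_of_add_one 4 c5
  have d0 := ContDiffAt.eventually_hasDerivAt 5 hφ6
  have d1 := ContDiffAt.eventually_hasDerivAt 4 c5
  have d2 := ContDiffAt.eventually_hasDerivAt 3 c4
  have hpos : ∀ᶠ x in 𝓝 0, 0 < deriv (deriv φ) x :=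
    c4.continuousAt.eventually (lt_mem_nhds hφ₂)
  set Q : ℝ → ℝ := fun x => deriv (deriv φ) x ^ (-2 / 3 : ℝ) with hQ
  have q0 : ContDiffAt ℝ (4 : ℕ) Q 0 := c4.rpow_const_of_ne hφ₂.ne'
  have q1 := ContDiffAt.deriv_of_add_one 3 q0
  have q2 := ContDiffAt.deriv_of_add_one 2 q1
  have e0 := ContDiffAt.eventually_hasDerivAt 3 q0
  have e1 := ContDiffAt.eventually_hasDerivAt 2 q1
  have e2 := ContDiffAt.eventually_hasDerivAt 1 q2
  refine exists_quadratic_relation d0 d1 hpos hφ hφ₁ (.of_forall fun _ => rfl) e0 e1 ?_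
  filter_upwards [hch, eventually_eventually_nhds.2 d0, eventually_eventually_nhds.2 d1,
    eventually_eventually_nhds.2 d2, eventually_eventually_nhds.2 hpos,
    eventually_eventually_nhds.2 e0, eventually_eventually_nhds.2 e1, e2]
    with c hc d0 d1 d2 hpos e0 e1 e2
  obtain ⟨a, b, U, hU, hab⟩ := hc
  set m := deriv φ c with hm
  have dψ : ∀ᶠ x in 𝓝 c, HasDerivAt (fun x => φ x - φ c - m * (x - c)) (deriv φ x - m) x := by
    filter_upwards [d0] with x hx
    have := (hx.sub_const (φ c)).sub (((hasDerivAt_id x).sub_const c).const_mul m)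
    simpa using! this
  have dψ1 : ∀ᶠ x in 𝓝 c, HasDerivAt (fun x => deriv φ x - m) (deriv (deriv φ) x) x := by
    filter_upwards [d1] with x hx using hx.sub_const m
  obtain ⟨ε, hε, H⟩ := Metric.eventually_nhds_iff_ball.1 (d1.and hpos)
  have hmono : StrictMonoOn (deriv φ) (Metric.ball c ε) := by
    refine strictMonoOn_of_hasDerivWithinAt_pos (f' := deriv (deriv φ)) (convex_ball _ _)
      (fun x hx => (H x hx).1.continuousAt.continuousWithinAt) (fun x hx => ?_) (fun x hx => ?_)
    · exact (H x (interior_subset hx)).1.hasDerivWithinAt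
    · exact (H x (interior_subset hx)).2
  have hrefl := eventually_apply_reflection_eq (b := b) dψ dψ1 hpos (by simp) (by simp [hm])
    ⟨U ∩ Metric.ball c ε, inter_mem hU (Metric.ball_mem_nhds c hε), by
      intro x hx y hy hxy hψ hx0 hy0
      have hx0' := sub_ne_zero.1 hx0
      have hy0' := sub_ne_zero.1 hy0
      -- The affine relation applied in both orders, with distinct reciprocals, forces `a = -1`.
      have h1 := hab x hx.1 y hy.1 hxy (by linarith) hx0' hy0'
      have h2 := hab y hy.1 x hx.1 hxy.symm (by linarith) hy0' hx0'
      have hne : (deriv φ x - m)⁻¹ ≠ (deriv φ y - m)⁻¹ := by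
        intro h
        have := sub_left_injective (inv_injective h)
        exact hxy (hmono.injOn hx.2 hy.2 this)
      have ha : (a + 1) * ((deriv φ x - m)⁻¹ - (deriv φ y - m)⁻¹) = 0 := by
        linear_combination h2 - h1
      have ha' : a = -1 := by
        rcases mul_eq_zero.1 ha with h | h
        · linarith
        · exact absurd (sub_eq_zero.1 h) hne
      rw [ha'] at h1
      linarith⟩
  have hz := affineCurvature_deriv_eq_zero dψ dψ1 d2 hpos (by simp) (by simp [hm])
    (.of_forall fun _ => rfl) e0 e1 e2 hrefl
  rwa [hz] at e2

/-! ### Linear maps with an open set of eigendirections in a subspace. -/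

/-- A linear map that preserves the directions of all vectors of a subspace close to a given nonzero
vector of that subspace is a homothety on the subspace. -/
theorem exists_eigenvalue_of_eventually {E : Type*} [NormedAddCommGroup E] [NormedSpace ℝ E]
    (g : E →ₗ[ℝ] E) (H : Submodule ℝ E) {ξ₀ : E} (hξ₀ : ξ₀ ∈ H) (h0 : ξ₀ ≠ 0)
    (h : ∀ᶠ ξ in 𝓝 ξ₀, ξ ∈ H → ∃ c : ℝ, g ξ = c • ξ) :
    ∃ c : ℝ, ∀ ξ ∈ H, g ξ = c • ξ := by
  obtain ⟨c₀, hc₀⟩ := h.self_of_nhds hξ₀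
  refine ⟨c₀, fun η hη => ?_⟩
  by_cases hdep : ∃ a : ℝ, η = a • ξ₀
  · obtain ⟨a, rfl⟩ := hdep
    rw [map_smul, hc₀, smul_comm]
  have hlim : ∀ k : ℝ, Tendsto (fun t : ℝ => ξ₀ + (k * t) • η) (𝓝[≠] 0) (𝓝 ξ₀) := fun k => by
    have : Continuous fun t : ℝ => ξ₀ + (k * t) • η := by fun_prop
    have := (this.tendsto 0).mono_left (nhdsWithin_le_nhds (s := {0}ᶜ))
    simpa using this
  -- Both `ξ₀ + t η` and `ξ₀ + 2 t η` are eigenvectors. Eliminating `g η` between them, with `η` and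
  -- `ξ₀` independent, shows that all the eigenvalues agree.
  obtain ⟨t, h1, h2, ht⟩ := (((hlim 1).eventually h).and
    (((hlim 2).eventually h).and self_mem_nhdsWithin)).exists
  have ht : t ≠ 0 := ht
  obtain ⟨c, hc⟩ := h1 (H.add_mem hξ₀ (H.smul_mem _ hη))
  obtain ⟨d, hd⟩ := h2 (H.add_mem hξ₀ (H.smul_mem _ hη))
  rw [map_add, map_smul, hc₀] at hc hd
  have hcd : (t * (2 * d - 2 * c)) • η = (c₀ - 2 * c₀ + 2 * c - d) • ξ₀ := by
    have e : (2 : ℝ) • (c₀ • ξ₀ + (1 * t) • g η) - (c₀ • ξ₀ + (2 * t) • g η) =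
      (2 : ℝ) • c • (ξ₀ + (1 * t) • η) - d • (ξ₀ + (2 * t) • η) := by rw [hc, hd]
    have e2 : c₀ • ξ₀ = (2 : ℝ) • c • (ξ₀ + (1 * t) • η) - d • (ξ₀ + (2 * t) • η) := by
      rw [← e]; module
    have e3 : c₀ • ξ₀ - (2 * c - d) • ξ₀ = (t * (2 * c - 2 * d)) • η := by
      rw [e2]; module
    calc (t * (2 * d - 2 * c)) • η = -((t * (2 * c - 2 * d)) • η) := by module
      _ = _ := by rw [← e3]; module
  have hcd0 : d = c := by
    by_contra hne
    have hk : t * (2 * d - 2 * c) ≠ 0 := mul_ne_zero ht (by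
      intro h; apply hne; linarith)
    exact hdep ⟨(t * (2 * d - 2 * c))⁻¹ * (c₀ - 2 * c₀ + 2 * c - d), by
      rw [mul_smul, ← hcd, smul_smul, inv_mul_cancel₀ hk, one_smul]⟩
  rw [hcd0] at hcd
  have hc0 : c = c₀ := by
    have : (c₀ - 2 * c₀ + 2 * c - c) • ξ₀ = 0 := by rw [← hcd]; simp
    have := (smul_eq_zero.1 this).resolve_right h0
    linarith
  rw [hc0, smul_add] at hc
  have h3 := add_left_cancel hc
  rw [smul_comm c₀] at h3
  have h1t : (1 * t : ℝ) ≠ 0 := by simpa using ht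
  exact smul_right_injective E h1t h3

/-! ### The Gauss map and the projective reflection. -/

namespace HypersurfaceGerm

variable {n : ℕ} {x₀ : Euc n} (α : HypersurfaceGerm n x₀)

theorem mem_tangent_iff_gradient (p u : Euc n) :
    u ∈ α.tangent p ↔ inner ℝ (gradient α.eqn p) u = 0 := by
  have h : fderiv ℝ α.eqn p u = inner ℝ (gradient α.eqn p) u := by
    rw [← toDual_gradient, InnerProductSpace.toDual_apply_apply]
  rw [← h]
  rfl

theorem mem_tangent_iff {p : Euc n} (hp : gradient α.eqn p ≠ 0) (u : Euc n) :
    u ∈ α.tangent p ↔ inner ℝ (α.normal p) u = 0 := by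
  rw [mem_tangent_iff_gradient, normal, real_inner_smul_left, mul_eq_zero, inv_eq_zero,
    norm_eq_zero]
  simp [hp]

theorem norm_normal {p : Euc n} (hp : gradient α.eqn p ≠ 0) : ‖α.normal p‖ = 1 := by
  rw [normal, norm_smul, norm_inv, norm_norm, inv_mul_cancel₀ (norm_ne_zero_iff.2 hp)]

theorem contDiffAt_gradient : ContDiffAt ℝ (5 : ℕ) (gradient α.eqn) x₀ := by
  have h : ContDiffAt ℝ (5 : ℕ) (fderiv ℝ α.eqn) x₀ := α.contDiffAt.fderiv_right (by norm_cast)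
  exact (InnerProductSpace.toDual ℝ (Euc n)).symm.contDiff.contDiffAt.comp x₀ h

theorem contDiffAt_normal : ContDiffAt ℝ (5 : ℕ) α.normal x₀ := by
  have h := α.contDiffAt_gradient
  exact ((h.norm ℝ α.gradient_ne_zero).inv (norm_ne_zero_iff.2 α.gradient_ne_zero)).smul h

theorem eventually_gradient_ne_zero : ∀ᶠ p in 𝓝 x₀, gradient α.eqn p ≠ 0 :=
  α.contDiffAt_gradient.continuousAt.eventually_ne α.gradient_ne_zero

/-- The Gauss map of a strictly convex hypersurface is locally open, also after projectivization. -/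
theorem eventually_gauss_open (hα : α.PosDefSecondForm) :
    ∀ᶠ O in 𝓝 x₀, O ∈ α.carrier → ∀ V ∈ 𝓝 O, ∀ᶠ ξ in 𝓝 (α.normal O),
      ∃ A ∈ V, A ∈ α.carrier ∧ ∃ l : ℝ, l ≠ 0 ∧ l • α.normal A = ξ := by
  have hg0 := α.gradient_ne_zero
  have hN : HasStrictFDerivAt α.normal (fderiv ℝ α.normal x₀) x₀ :=
    α.contDiffAt_normal.hasStrictFDerivAt (by simp)
  have hF : HasStrictFDerivAt α.eqn (fderiv ℝ α.eqn x₀) x₀ :=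
    α.contDiffAt.hasStrictFDerivAt (by simp)
  -- The derivative of `(A, l) ↦ (l n(A), eqn A)` at `(x₀, 1)`. Carrying the equation as an extra
  -- coordinate lets the inverse function theorem work in the ambient space, without charts on the
  -- hypersurface.
  set D : Euc n × ℝ →L[ℝ] Euc n × ℝ := ((1 : ℝ) • (fderiv ℝ α.normal x₀ ∘L
    ContinuousLinearMap.fst ℝ (Euc n) ℝ) + (ContinuousLinearMap.snd ℝ (Euc n) ℝ).smulRight
      (α.normal x₀)).prod (fderiv ℝ α.eqn x₀ ∘L ContinuousLinearMap.fst ℝ (Euc n) ℝ)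
  have hΨ : HasStrictFDerivAt (fun y : Euc n × ℝ => (y.2 • α.normal y.1, α.eqn y.1)) D (x₀, 1) :=
    ((hasStrictFDerivAt_snd (𝕜 := ℝ) (p := (x₀, (1 : ℝ)))).smul
      (HasStrictFDerivAt.comp (x₀, (1 : ℝ)) hN hasStrictFDerivAt_fst)).prodMk
      (HasStrictFDerivAt.comp (x₀, (1 : ℝ)) hF hasStrictFDerivAt_fst)
  have hinj : Function.Injective (D : Euc n × ℝ →ₗ[ℝ] Euc n × ℝ) := by
    rw [← LinearMap.ker_eq_bot, LinearMap.ker_eq_bot']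
    rintro ⟨u, μ⟩ h
    have h' : (1 : ℝ) • fderiv ℝ α.normal x₀ u + μ • α.normal x₀ = 0 ∧ fderiv ℝ α.eqn x₀ u = 0 :=
      Prod.ext_iff.1 h
    obtain ⟨h1, h2⟩ := h'
    have hu : u ∈ α.tangent x₀ := h2
    have hNu := (α.mem_tangent_iff hg0 u).1 hu
    -- Pairing the kernel equation with the tangent vector `u` leaves the second fundamental form at
    -- `u`, which is positive unless `u = 0`.
    have hu0 : u = 0 := by
      by_contra hne
      have hp := hα u hu hne
      have : inner ℝ ((1 : ℝ) • fderiv ℝ α.normal x₀ u + μ • α.normal x₀) u = 0 := by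
        rw [h1, inner_zero_left]
      rw [inner_add_left, one_smul, real_inner_smul_left, hNu] at this
      rw [secondForm] at hp
      linarith
    subst hu0
    have hN0 : α.normal x₀ ≠ 0 := by
      rw [← norm_ne_zero_iff, α.norm_normal hg0]
      exact one_ne_zero
    have : μ = 0 := by simpa [hN0] using h1
    rw [this]
    rfl
  set e := (LinearEquiv.ofInjectiveEndo _ hinj).toContinuousLinearEquiv
  have he : (e : Euc n × ℝ →L[ℝ] Euc n × ℝ) = D := by
    ext x <;> rfl
  rw [← he] at hΨ
  set T := hΨ.toOpenPartialHomeomorph with hT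
  have hTc : ∀ y : Euc n × ℝ, T y = (y.2 • α.normal y.1, α.eqn y.1) := fun _ => rfl
  have hsrc : (x₀, (1 : ℝ)) ∈ T.source := hΨ.mem_toOpenPartialHomeomorph_source
  have hmap : Tendsto (fun O : Euc n => (O, (1 : ℝ))) (𝓝 x₀) (𝓝 (x₀, 1)) := by
    have : Continuous fun O : Euc n => (O, (1 : ℝ)) := by fun_prop
    exact this.tendsto x₀
  filter_upwards [hmap.eventually (T.open_source.mem_nhds hsrc),
    eventually_eventually_nhds.2 α.mem_iff] with O hO hmem hOc V hV
  have hFO : α.eqn O = 0 := hmem.self_of_nhds.1 hOc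
  have hTO : T (O, 1) = (α.normal O, 0) := by rw [hTc, hFO, one_smul]
  have hsymm : Tendsto T.symm (𝓝 (α.normal O, 0)) (𝓝 (O, 1)) := by
    rw [← hTO]
    exact T.tendsto_symm hO
  have htgt : ∀ᶠ z in 𝓝 (α.normal O, (0 : ℝ)), T (T.symm z) = z := by
    rw [← hTO]
    exact T.eventually_right_inverse' hO
  have hin : Tendsto (fun ξ : Euc n => (ξ, (0 : ℝ))) (𝓝 (α.normal O)) (𝓝 (α.normal O, 0)) := by
    have : Continuous fun ξ : Euc n => (ξ, (0 : ℝ)) := by fun_prop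
    exact this.tendsto _
  have hcomp := hsymm.comp hin
  filter_upwards [hin.eventually htgt,
    ((continuous_fst.tendsto (O, (1 : ℝ))).comp hcomp).eventually hV,
    ((continuous_fst.tendsto (O, (1 : ℝ))).comp hcomp).eventually hmem,
    ((continuous_snd.tendsto (O, (1 : ℝ))).comp hcomp).eventually_ne one_ne_zero]
    with ξ h1 h2 h3 h4
  rw [hTc, Prod.mk.injEq] at h1
  exact ⟨_, h2, h3.2 h1.2, _, h4, h1.1⟩

/-- The case `A = B` matters as much as genuine chords: it makes the normals at points of tangency
fixed by the reflection. -/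
theorem paired_of_smul {O e A B : Euc n} (hA : A ∈ α.carrier) (hB : B ∈ α.carrier)
    (h : ∃ t : ℝ, B - A = t • e) (ht : A = B → e ∈ α.tangent A) :
    α.Paired (AffineSubspace.mk' O (Submodule.span ℝ {e})) A B := by
  refine ⟨hA, hB, AffineSubspace.mk' A (Submodule.span ℝ {e}), ?_, AffineSubspace.self_mem_mk' _ _,
    ?_, fun hAB => ?_⟩
  · rw [AffineSubspace.parallel_iff_direction_eq_and_eq_bot_iff_eq_bot]
    simp only [AffineSubspace.direction_mk', true_and]
    have h1 : ∀ p : Euc n, AffineSubspace.mk' p (Submodule.span ℝ {e}) ≠ ⊥ := fun p =>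
      (AffineSubspace.nonempty_iff_ne_bot _).1 ⟨p, AffineSubspace.self_mem_mk' _ _⟩
    simp [h1]
  · obtain ⟨t, ht⟩ := h
    rw [AffineSubspace.mem_mk', vsub_eq_sub, ht]
    exact Submodule.smul_mem _ _ (Submodule.mem_span_singleton_self e)
  · rw [AffineSubspace.direction_mk', Submodule.span_singleton_le_iff_mem]
    exact ht hAB

/-- When the reflection at `O` is projective, it acts by a fixed affine map on the ratios of
coordinates of the normal in a plane containing the direction of the chords. -/
theorem eventually_normal_ratio (hα : α.PosDefSecondForm) :
    ∀ᶠ O in 𝓝 x₀, O ∈ α.carrier → ∀ e : Euc n, e ≠ 0 → e ∈ α.tangent O →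
      α.ReflectionIsProjective (AffineSubspace.mk' O (Submodule.span ℝ {e})) O →
      ∀ v : Euc n, ∃ a b : ℝ, ∃ U ∈ 𝓝 O, ∀ A ∈ U, ∀ B ∈ U, A ∈ α.carrier → B ∈ α.carrier →
        A ≠ B → (∃ t : ℝ, B - A = t • e) →
        inner ℝ (α.normal A) e ≠ 0 → inner ℝ (α.normal B) e ≠ 0 →
        inner ℝ (α.normal B) v / inner ℝ (α.normal B) e =
          a * (inner ℝ (α.normal A) v / inner ℝ (α.normal A) e) + b := by
  filter_upwards [α.eventually_gauss_open hα,
    eventually_eventually_nhds.2 α.eventually_gradient_ne_zero,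
    α.contDiffAt_normal.eventually (by simp)] with O hopen hgrad hNO hOc e he heO hR v
  obtain ⟨f, ⟨U₀, hU₀, hf⟩, hlift⟩ := hR
  have hsph : ∀ p, gradient α.eqn p ≠ 0 → α.normal p ∈ Metric.sphere (0 : Euc n) 1 := fun p hp => by
    rw [mem_sphere_zero_iff_norm, α.norm_normal hp]
  obtain ⟨g, hg⟩ := hlift ⟨α.normal O, hsph O hgrad.self_of_nhds⟩ rfl
  have hg' : ∀ᶠ A in 𝓝 O, ∀ ν : Metric.sphere (0 : Euc n) 1, (ν : Euc n) = α.normal A →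
      toRP (f ν) = Projectivization.map (g : Euc n →ₗ[ℝ] Euc n) g.injective (toRP ν) := by
    rw [nhds_subtype_eq_comap, eventually_comap] at hg
    filter_upwards [hNO.continuousAt.eventually hg] with A hA ν hν using hA ν hν
  set U := {A | A ∈ U₀ ∧ gradient α.eqn A ≠ 0 ∧
    ∀ ν : Metric.sphere (0 : Euc n) 1, (ν : Euc n) = α.normal A →
      toRP (f ν) = Projectivization.map (g : Euc n →ₗ[ℝ] Euc n) g.injective (toRP ν)} with hU
  have hUn : U ∈ 𝓝 O := Filter.Eventually.and hU₀ (hgrad.and hg')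
  have hne : ∀ A ∈ U, α.normal A ≠ 0 := fun A hA => by
    rw [← norm_ne_zero_iff, α.norm_normal hA.2.1]
    exact one_ne_zero
  have hpair : ∀ A ∈ U, ∀ B ∈ U,
      α.Paired (AffineSubspace.mk' O (Submodule.span ℝ {e})) A B →
      ∃ k : ℝ, k • g (α.normal A) = α.normal B := by
    intro A hA B hB hAB
    have h1 := hA.2.2 ⟨α.normal A, hsph A hA.2.1⟩ rfl
    have h2 := hf A hA.1 B hB.1 hAB ⟨α.normal A, hsph A hA.2.1⟩ rfl
    rw [toRP, toRP, Projectivization.map_mk, Projectivization.mk_eq_mk_iff'] at h1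
    obtain ⟨k, hk⟩ := h1
    exact ⟨k, by rw [← h2, ← hk]; rfl⟩
  -- A vector orthogonal to `e` and close to the normal at `O` is a multiple of the normal at a
  -- point where `e` is tangent. That point is paired with itself.
  have heig : ∀ᶠ ξ in 𝓝 (α.normal O), ξ ∈ LinearMap.ker (innerₛₗ ℝ e) →
      ∃ c : ℝ, (g : Euc n →ₗ[ℝ] Euc n) ξ = c • ξ := by
    filter_upwards [hopen hOc U hUn] with ξ hξ hξe
    obtain ⟨A, hAU, hAc, l, hl, rfl⟩ := hξ
    have hin : inner ℝ (α.normal A) e = 0 := by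
      have : inner ℝ e (l • α.normal A) = 0 := hξe
      rw [real_inner_smul_right, mul_eq_zero, real_inner_comm] at this
      exact this.resolve_left hl
    obtain ⟨k, hk⟩ := hpair A hAU A hAU (α.paired_of_smul hAc hAc ⟨0, by simp⟩
      fun _ => (α.mem_tangent_iff hAU.2.1 e).2 hin)
    have hk0 : k ≠ 0 := by
      rintro rfl
      rw [zero_smul] at hk
      exact hne A hAU hk.symm
    refine ⟨k⁻¹, ?_⟩
    rw [LinearEquiv.coe_coe, map_smul, smul_comm]
    congr 1
    nth_rewrite 2 [← hk]
    rw [smul_smul, inv_mul_cancel₀ hk0, one_smul]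
  obtain ⟨c, hc⟩ := exists_eigenvalue_of_eventually (g : Euc n →ₗ[ℝ] Euc n) _
    (by
      change inner ℝ e (α.normal O) = 0
      rw [real_inner_comm]
      exact (α.mem_tangent_iff hgrad.self_of_nhds e).1 heO)
    (hne O (mem_of_mem_nhds hUn)) heig
  -- Normalised by `⟨u, e⟩ = 1`, so `ξ - ⟨ξ, e⟩ u` lies in the hyperplane where `g` is the scalar
  -- `c`.
  set u : Euc n := (inner ℝ e e)⁻¹ • e with hu
  have hee : inner ℝ e e ≠ 0 := by simpa using he
  set w : Euc n := g u - c • u with hw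
  have hgξ : ∀ ξ : Euc n, g ξ = c • ξ + inner ℝ ξ e • w := fun ξ => by
    have h1 : ξ - inner ℝ ξ e • u ∈ LinearMap.ker (innerₛₗ ℝ e) := by
      change inner ℝ e (ξ - inner ℝ ξ e • u) = 0
      rw [hu, inner_sub_right, real_inner_smul_right, real_inner_smul_right, inv_mul_cancel₀ hee,
        mul_one, real_inner_comm, sub_self]
    have h2 := hc _ h1
    rw [LinearEquiv.coe_coe, map_sub, map_smul, sub_eq_iff_eq_add] at h2
    rw [h2, hw]
    module
  -- These come from dividing `⟨g ξ, v⟩` by `⟨g ξ, e⟩`; the unknown projective factor `k` cancels.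
  -- The denominator is shown nonzero from `⟨n(B), e⟩ ≠ 0`.
  refine ⟨c / (c + inner ℝ w e), inner ℝ w v / (c + inner ℝ w e), U, hUn, ?_⟩
  intro A hA B hB hAc hBc hAB ht hAe hBe
  obtain ⟨k, hk⟩ := hpair A hA B hB (α.paired_of_smul hAc hBc ht fun h => absurd h hAB)
  rw [hgξ] at hk
  have hx : ∀ y : Euc n, inner ℝ (α.normal B) y =
      k * (c * inner ℝ (α.normal A) y + inner ℝ (α.normal A) e * inner ℝ w y) := fun y => by
    rw [← hk, real_inner_smul_left, inner_add_left, real_inner_smul_left, real_inner_smul_left]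
  have hBe' : inner ℝ (α.normal B) e = k * (inner ℝ (α.normal A) e * (c + inner ℝ w e)) := by
    rw [hx e]
    ring
  rw [hBe'] at hBe ⊢
  have hk0 : k ≠ 0 := left_ne_zero_of_mul hBe
  have hcw : c + inner ℝ w e ≠ 0 := right_ne_zero_of_mul (right_ne_zero_of_mul hBe)
  rw [hx v]
  field_simp

end HypersurfaceGerm

/-! ### The plane section as a graph. -/

namespace HypersurfaceGerm

variable {n : ℕ} {x₀ : Euc n} (α : HypersurfaceGerm n x₀)

/-- A basis of a transversal plane, consisting of a tangent and an inward vector. -/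
theorem exists_adapted_basis {P : AffineSubspace ℝ (Euc n)}
    (hP : Module.finrank ℝ P.direction = 2) (htr : α.TransversalTo P) :
    ∃ e ∈ P.direction, ∃ v ∈ P.direction, e ∈ α.tangent x₀ ∧ e ≠ 0 ∧
      inner ℝ (α.normal x₀) v < 0 ∧ LinearIndependent ℝ ![e, v] ∧
      ∀ x ∈ P.direction, ∃ s t : ℝ, x = s • e + t • v := by
  have hg0 := α.gradient_ne_zero
  obtain ⟨v, hv, hNv⟩ : ∃ v ∈ P.direction, inner ℝ (α.normal x₀) v < 0 := by
    obtain ⟨v, hv, hNv⟩ : ∃ v ∈ P.direction, inner ℝ (α.normal x₀) v ≠ 0 := by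
      by_contra! hcon
      have hle : P.direction ≤ α.tangent x₀ := fun v hv =>
        (α.mem_tangent_iff hg0 v).2 (hcon v hv)
      have htop : α.tangent x₀ = ⊤ := by rw [← htr.2, sup_eq_left.2 hle]
      have : α.normal x₀ ∈ α.tangent x₀ := by rw [htop]; trivial
      rw [α.mem_tangent_iff hg0, real_inner_self_eq_norm_sq, α.norm_normal hg0] at this
      norm_num at this
    rcases hNv.lt_or_gt with h | h
    · exact ⟨v, hv, h⟩
    · exact ⟨-v, P.direction.neg_mem hv, by rw [inner_neg_right]; linarith⟩
  obtain ⟨w, hw, hwv⟩ : ∃ w ∈ P.direction, w ∉ Submodule.span ℝ {v} := by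
    by_contra! hcon
    have h1 := Submodule.finrank_mono (show P.direction ≤ Submodule.span ℝ {v} from hcon)
    have h2 := finrank_span_singleton (K := ℝ) (v := v) (by rintro rfl; simp at hNv)
    omega
  set k := inner ℝ (α.normal x₀) w / inner ℝ (α.normal x₀) v with hk
  have he0 : w - k • v ≠ 0 := fun h => hwv (by
    rw [sub_eq_zero.1 h]
    exact Submodule.smul_mem _ _ (Submodule.mem_span_singleton_self v))
  have heN : inner ℝ (α.normal x₀) (w - k • v) = 0 := by
    rw [inner_sub_right, real_inner_smul_right, hk, div_mul_cancel₀ _ hNv.ne, sub_self]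
  have heP : w - k • v ∈ P.direction := P.direction.sub_mem hw (P.direction.smul_mem _ hv)
  have hli : LinearIndependent ℝ ![w - k • v, v] := by
    rw [LinearIndependent.pair_iff]
    intro s t hst
    have h1 := congrArg (fun x => inner ℝ (α.normal x₀) x) hst
    simp only [inner_add_right, real_inner_smul_right, heN, mul_zero, zero_add,
      inner_zero_right] at h1
    have ht : t = 0 := (mul_eq_zero.1 h1).resolve_right hNv.ne
    rw [ht, zero_smul, add_zero] at hst
    exact ⟨(smul_eq_zero.1 hst).resolve_right he0, ht⟩
  refine ⟨w - k • v, heP, v, hv, (α.mem_tangent_iff hg0 _).2 heN, he0, hNv, hli, ?_⟩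
  have hspan : Submodule.span ℝ (Set.range ![w - k • v, v]) = P.direction := by
    apply Submodule.eq_of_le_of_finrank_eq
    · rw [Submodule.span_le]
      rintro _ ⟨i, rfl⟩
      fin_cases i
      · exact heP
      · exact hv
    · rw [finrank_span_eq_card hli, hP]
      rfl
  intro x hx
  rw [← hspan, Matrix.range_cons, Matrix.range_cons, Matrix.range_empty, Set.union_empty,
    Set.singleton_union, Submodule.mem_span_pair] at hx
  obtain ⟨s, t, h⟩ := hx
  exact ⟨s, t, h.symm⟩

/-- The section of the hypersurface by the plane spanned by a vector `e` and a vector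
`v` transversal to the hypersurface is the graph of a smooth function. -/
theorem exists_section_graph {e v : Euc n}
    (hv : inner ℝ (α.normal x₀) v ≠ 0) :
    ∃ φ : ℝ → ℝ, ContDiffAt ℝ 6 φ 0 ∧ φ 0 = 0 ∧
      ∀ᶠ z : ℝ × ℝ in 𝓝 (0, 0), x₀ + z.1 • e + z.2 • v ∈ α.carrier ↔ φ z.1 = z.2 := by
  set f : ℝ × ℝ → ℝ := fun z => α.eqn (x₀ + z.1 • e + z.2 • v) with hf
  set χ : ℝ × ℝ → Euc n := fun z => x₀ + z.1 • e + z.2 • v with hχ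
  have hχc : ContDiff ℝ 6 χ := by fun_prop
  have hχ0 : χ (0, 0) = x₀ := by simp [hχ]
  have hF : ContDiffAt ℝ 6 α.eqn (χ (0, 0)) := by
    rw [hχ0]
    exact α.contDiffAt
  have hfc : ContDiffAt ℝ 6 f (0, 0) := hF.comp (0, 0) hχc.contDiffAt
  have hfv : fderiv ℝ f (0, 0) (0, 1) = fderiv ℝ α.eqn x₀ v := by
    have h1 : HasDerivAt (fun t : ℝ => ((0 : ℝ), t)) (0, 1) 0 :=
      (hasDerivAt_const _ _).prodMk (hasDerivAt_id _)
    have h2 := (hfc.differentiableAt (by simp)).hasFDerivAt.comp_hasDerivAt (0 : ℝ) h1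
    have h3 : HasDerivAt (fun t : ℝ => χ (0, t)) v 0 := by
      have := ((hasDerivAt_id (0 : ℝ)).smul_const v).const_add x₀
      simpa [hχ] using! this
    have h4 := (hF.differentiableAt (by simp)).hasFDerivAt.comp_hasDerivAt (0 : ℝ) h3
    rw [hχ0] at h4
    exact h2.unique h4
  have hfv0 : fderiv ℝ f (0, 0) (0, 1) ≠ 0 := by
    rw [hfv]
    intro h
    exact hv ((α.mem_tangent_iff α.gradient_ne_zero v).1 h)
  have hinv : (fderiv ℝ f (0, 0) ∘L .inr ℝ ℝ ℝ).IsInvertible :=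
    ⟨ContinuousLinearEquiv.unitsEquivAut ℝ (Units.mk0 _ hfv0), by ext; simp⟩
  have hf0 : f (0, 0) = 0 := by
    change α.eqn (χ (0, 0)) = 0
    rw [hχ0]
    exact α.mem_iff.self_of_nhds.1 α.base_mem
  refine ⟨hfc.implicitFunction (by simp) hinv, hfc.contDiffAt_implicitFunction (by simp) hinv,
    hfc.implicitFunction_apply_self (by simp) hinv, ?_⟩
  have hχt : Tendsto χ (𝓝 (0, 0)) (𝓝 x₀) := by
    have := hχc.continuous.tendsto (0, 0)
    rwa [hχ0] at this
  filter_upwards [hfc.eventually_apply_eq_iff_implicitFunction (by simp) hinv,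
    hχt.eventually α.mem_iff] with z hz1 hz2
  rw [hf0] at hz1
  exact hz2.trans hz1

end HypersurfaceGerm

/-! ### Conics, contact and the conclusion. -/

/-- A curve has contact of any order with a set that contains it. -/
theorem HasContactGT.of_eventually_mem {n k : ℕ} {β C : Set (Euc n)} {O : Euc n} {γ : ℝ → Euc n}
    (h : ContDiffAt ℝ k γ 0) (h0 : γ 0 = O) (h1 : deriv γ 0 ≠ 0)
    (hmem : ∀ᶠ t in 𝓝 0, γ t ∈ β ∧ γ t ∈ C) : HasContactGT k β C O :=
  ⟨γ, γ, h, h, h0, h0, h1, h1, hmem, by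
    simp⟩

/-- The matrix of this equation has determinant `-p`, so `p ≠ 0` is exactly nondegeneracy. The
missing constant and linear `s` terms make the conic pass through `x₀` tangent to `e`. -/
theorem isConicIn_of_quadratic {n : ℕ} {P : AffineSubspace ℝ (Euc n)} {x₀ e v : Euc n}
    (hx₀ : x₀ ∈ P) (he : e ∈ P.direction) (hv : v ∈ P.direction)
    (hli : LinearIndependent ℝ ![e, v]) {p q r : ℝ} (hp : p ≠ 0) :
    IsConicIn P {x | ∃ s t : ℝ, x = x₀ + s • e + t • v ∧
      p * s ^ 2 + 2 * q * s * t + r * t ^ 2 - 2 * t = 0} := by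
  refine ⟨⟨x₀, 0, 0, by simp⟩, x₀, hx₀, e, he, v, hv, hli,
    !![p, q, 0; q, r, -1; 0, -1, 0], ?_, ?_, ?_⟩
  · ext i j
    fin_cases i <;> fin_cases j <;> rfl
  · simpa [Matrix.det_fin_three] using hp
  · ext x
    refine exists_congr fun s => exists_congr fun t => and_congr_right fun _ => ?_
    have : ![s, t, 1] ⬝ᵥ (!![p, q, 0; q, r, -1; 0, -1, 0] : Matrix (Fin 3) (Fin 3) ℝ).mulVec
        ![s, t, 1] = p * s ^ 2 + 2 * q * s * t + r * t ^ 2 - 2 * t := by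
      simp [Matrix.mulVec, dotProduct, Fin.sum_univ_three]
      ring
    rw [this]

theorem theorem3p1 {n : ℕ} {x₀ : Euc n} (α : HypersurfaceGerm n x₀)
    (hα : α.PosDefSecondForm)
    (P : AffineSubspace ℝ (Euc n)) (hP : Module.finrank ℝ P.direction = 2)
    (htr : α.TransversalTo P)
    (hproj : ∀ᶠ O in 𝓝 x₀, O ∈ α.planeSection P →
      ∀ L : AffineSubspace ℝ (Euc n), α.IsSectionTangentLine P L O →
        α.ReflectionIsProjective L O) :
    (∃ C : Set (Euc n), IsConicIn P C ∧ ∀ᶠ x in 𝓝 x₀, x ∈ α.planeSection P ↔ x ∈ C) ∧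
      ∀ᶠ O in 𝓝 x₀, O ∈ α.planeSection P → IsSextactic P (α.planeSection P) O := by
  have hg0 := α.gradient_ne_zero
  obtain ⟨e, heP, v, hvP, heT, he0, hNv, hli, hbas⟩ := α.exists_adapted_basis hP htr
  have heN : inner ℝ (α.normal x₀) e = 0 := (α.mem_tangent_iff hg0 e).1 heT
  obtain ⟨φ, hφ6, hφ0, hφ⟩ := α.exists_section_graph (e := e) hNv.ne
  have hφc : Tendsto φ (𝓝 0) (𝓝 0) := by
    have := hφ6.continuousAt.tendsto
    rwa [hφ0] at this
  have dφ := ContDiffAt.eventually_hasDerivAt 5 hφ6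
  have dφ1 := ContDiffAt.eventually_hasDerivAt 4 (ContDiffAt.deriv_of_add_one 5 hφ6)
  set A : ℝ → Euc n := fun s => x₀ + s • e + φ s • v with hA
  have hA0 : A 0 = x₀ := by simp [hA, hφ0]
  have hAt : Tendsto A (𝓝 0) (𝓝 x₀) := by
    have : ContinuousAt A 0 :=
      (continuousAt_const.add (continuousAt_id.smul continuousAt_const)).add
        (hφ6.continuousAt.smul continuousAt_const)
    have := this.tendsto
    rwa [hA0] at this
  have hAP : ∀ s, A s ∈ P := fun s => by
    have : A s = (s • e + φ s • v) +ᵥ x₀ := by simp only [hA, vadd_eq_add]; abel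
    rw [this]
    exact AffineSubspace.vadd_mem_of_mem_direction
      (P.direction.add_mem (P.direction.smul_mem _ heP) (P.direction.smul_mem _ hvP)) htr.1
  have hAC : ∀ᶠ s in 𝓝 0, A s ∈ α.carrier := by
    have : Tendsto (fun s => (s, φ s)) (𝓝 0) (𝓝 (0, 0)) := tendsto_id.prodMk_nhds hφc
    filter_upwards [this.eventually hφ] with s hs using hs.2 rfl
  have dA : ∀ᶠ s in 𝓝 0, HasDerivAt A (e + deriv φ s • v) s := by
    filter_upwards [dφ] with s hs
    have := (((hasDerivAt_id s).smul_const e).const_add x₀).add (hs.smul_const v)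
    simpa using! this
  have hve0 : ∀ k : ℝ, e + k • v ≠ 0 := fun k h => by
    have := (LinearIndependent.pair_iff.1 hli) 1 k (by rw [one_smul]; exact h)
    exact one_ne_zero this.1
  have hdiff : ∀ᶠ p in 𝓝 x₀, DifferentiableAt ℝ α.eqn p := by
    filter_upwards [α.contDiffAt.eventually (by simp)] with p hp using hp.differentiableAt (by simp)
  have hAT : ∀ᶠ s in 𝓝 0, e + deriv φ s • v ∈ α.tangent (A s) := by
    filter_upwards [dA, eventually_eventually_nhds.2 hAC,
      hAt.eventually (eventually_eventually_nhds.2 α.mem_iff), hAt.eventually hdiff]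
      with s hs hsC hsm hsd
    have h1 := hsd.hasFDerivAt.comp_hasDerivAt s hs
    have h2 : (α.eqn ∘ A) =ᶠ[𝓝 s] fun _ => 0 := by
      filter_upwards [hsC, hs.continuousAt.eventually hsm] with y hy hy' using hy'.1 hy
    exact h1.unique ((hasDerivAt_const s (0 : ℝ)).congr_of_eventuallyEq h2)
  have hAN : ∀ᶠ s in 𝓝 0, inner ℝ (α.normal (A s)) (e + deriv φ s • v) = 0 := by
    filter_upwards [hAT, hAt.eventually α.eventually_gradient_ne_zero] with s hs hsg
    exact (α.mem_tangent_iff hsg _).1 hs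
  have hφ1 : deriv φ 0 = 0 := by
    have := hAN.self_of_nhds
    rw [hA0, inner_add_right, heN, zero_add, real_inner_smul_right, mul_eq_zero] at this
    exact this.resolve_right hNv.ne
  -- Differentiating `⟨n, e + φ' v⟩ = 0` along the section at `0` gives `II(e, e) + φ'' 0 * ⟨n, v⟩ =
  -- 0`, and `⟨n, v⟩ < 0` because `v` points inward.
  have hφ2 : 0 < deriv (deriv φ) 0 := by
    have hN : HasFDerivAt α.normal (fderiv ℝ α.normal x₀) (A 0) := by
      rw [hA0]
      exact (α.contDiffAt_normal.differentiableAt (by simp)).hasFDerivAt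
    have h1 := (hN.comp_hasDerivAt (0 : ℝ) dA.self_of_nhds).inner ℝ
      ((dφ1.self_of_nhds.smul_const v).const_add e)
    have h2 := h1.unique ((hasDerivAt_const (0 : ℝ) (0 : ℝ)).congr_of_eventuallyEq hAN)
    rw [hφ1, zero_smul, add_zero, real_inner_smul_right, Function.comp_apply, hA0] at h2
    have h3 : 0 < inner ℝ (fderiv ℝ α.normal x₀ e) e := hα e heT he0
    by_contra hcon
    have := mul_nonneg_of_nonpos_of_nonpos (not_lt.1 hcon) hNv.le
    linarith
  have hNvn : ∀ᶠ p in 𝓝 x₀, inner ℝ (α.normal p) v ≠ 0 := by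
    have : ContinuousAt (fun p => inner ℝ (α.normal p) v) x₀ :=
      α.contDiffAt_normal.continuousAt.inner continuousAt_const
    exact this.eventually_ne hNv.ne
  have hch : ∀ᶠ c in 𝓝 0, ∃ a b : ℝ, ∃ U ∈ 𝓝 c, ∀ x ∈ U, ∀ y ∈ U, x ≠ y →
      φ y - φ x = deriv φ c * (y - x) → deriv φ x ≠ deriv φ c → deriv φ y ≠ deriv φ c →
      (deriv φ y - deriv φ c)⁻¹ = a * (deriv φ x - deriv φ c)⁻¹ + b := by
    filter_upwards [hAC, eventually_eventually_nhds.2 hAC, hAT, dA,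
      eventually_eventually_nhds.2 hAN, hAt.eventually (α.eventually_normal_ratio hα),
      hAt.eventually hproj, eventually_eventually_nhds.2 (hAt.eventually hNvn)]
      with c hcC hcC' hcT hcd hcN hratio hpr hcv
    set m := deriv φ c
    have hline : α.IsSectionTangentLine P
        (AffineSubspace.mk' (A c) (Submodule.span ℝ {e + m • v})) (A c) := by
      have hdir : e + m • v ∈ P.direction := P.direction.add_mem heP (P.direction.smul_mem _ hvP)
      refine ⟨?_, AffineSubspace.self_mem_mk' _ _, ?_, ?_⟩
      · rw [AffineSubspace.direction_mk']
        exact finrank_span_singleton (hve0 m)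
      · intro x hx
        rw [AffineSubspace.mem_mk'] at hx
        have hx' := (Submodule.span_singleton_le_iff_mem _ _).2 hdir hx
        rw [← vsub_vadd x (A c)]
        exact AffineSubspace.vadd_mem_of_mem_direction hx' (hAP c)
      · rw [AffineSubspace.direction_mk', Submodule.span_singleton_le_iff_mem]
        exact hcT
    -- With chord direction `e + m v`, the ratio of normal coordinates at `A z` is `-(φ' z - m)⁻¹`.
    -- The minus sign is why the offset becomes `-b`.
    obtain ⟨a, b, U, hU, hab⟩ := hratio hcC _ (hve0 m) hcT (hpr ⟨hcC, hAP c⟩ _ hline) v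
    refine ⟨a, -b, _, inter_mem (hcd.continuousAt.preimage_mem_nhds hU)
      (hcC'.and (hcN.and hcv)), ?_⟩
    rintro x ⟨hxU, hxC, hxN, hxv⟩ y ⟨hyU, hyC, hyN, hyv⟩ hxy hch hxm hym
    have hin : ∀ z, inner ℝ (α.normal (A z)) (e + deriv φ z • v) = 0 →
        inner ℝ (α.normal (A z)) (e + m • v) =
          -((deriv φ z - m) * inner ℝ (α.normal (A z)) v) := by
      intro z hz
      rw [inner_add_right, real_inner_smul_right] at hz ⊢
      linear_combination hz
    have hsub : A y - A x = (y - x) • (e + m • v) := by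
      have : A y - A x = (y - x) • e + (φ y - φ x) • v := by simp only [hA]; module
      rw [this, hch]
      module
    have hAne : A x ≠ A y := fun h => by
      rw [h, sub_self, eq_comm, smul_eq_zero] at hsub
      exact hsub.elim (fun h => hxy (sub_eq_zero.1 h).symm) (hve0 m)
    have hxm' := sub_ne_zero.2 hxm
    have hym' := sub_ne_zero.2 hym
    have := hab _ hxU _ hyU hxC hyC hAne ⟨_, hsub⟩
      (by rw [hin x hxN]; exact neg_ne_zero.2 (mul_ne_zero hxm' hxv))
      (by rw [hin y hyN]; exact neg_ne_zero.2 (mul_ne_zero hym' hyv))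
    have hdiv : ∀ d w : ℝ, w ≠ 0 → w / -(d * w) = -d⁻¹ := fun d w hw => by
      rw [div_neg, mul_comm, div_mul_cancel_left₀ hw]
    rw [hin x hxN, hin y hyN, hdiv _ _ hxv, hdiv _ _ hyv] at this
    linear_combination -this
  obtain ⟨p, q, r, hp, hquad⟩ := exists_quadratic_relation_of_chords hφ6 hφ0 hφ1 hφ2 hch
  set C : Set (Euc n) := {x | ∃ s t : ℝ, x = x₀ + s • e + t • v ∧
      p * s ^ 2 + 2 * q * s * t + r * t ^ 2 - 2 * t = 0} with hC
  have hconic : IsConicIn P C := isConicIn_of_quadratic htr.1 heP hvP hli hp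
  -- The plane coordinates `(s, t)` are extended to affine functions on the whole space, so that
  -- conditions near `(0, 0)` pull back to conditions near `x₀`. The normal at `x₀` kills `e`, which
  -- isolates `t`.
  set κt : Euc n → ℝ := fun x =>
    inner ℝ (α.normal x₀) (x - x₀) / inner ℝ (α.normal x₀) v with hκt
  set κs : Euc n → ℝ := fun x => (inner ℝ e (x - x₀) - κt x * inner ℝ e v) / inner ℝ e e with hκs
  have hee : inner ℝ e e ≠ 0 := by simpa using he0
  have hκ : ∀ s t : ℝ, κs (x₀ + s • e + t • v) = s ∧ κt (x₀ + s • e + t • v) = t := by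
    intro s t
    have h1 : x₀ + s • e + t • v - x₀ = s • e + t • v := by abel
    have h2 : κt (x₀ + s • e + t • v) = t := by
      simp only [hκt]
      rw [h1, inner_add_right, real_inner_smul_right, real_inner_smul_right, heN, mul_zero,
        zero_add, mul_div_assoc, div_self hNv.ne, mul_one]
    refine ⟨?_, h2⟩
    simp only [hκs]
    rw [h2, h1, inner_add_right, real_inner_smul_right, real_inner_smul_right, add_sub_cancel_right,
      mul_div_assoc, div_self hee, mul_one]
  have hκlim : Tendsto (fun x => (κs x, κt x)) (𝓝 x₀) (𝓝 (0, 0)) := by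
    have hc : Continuous fun x => (κs x, κt x) := by
      have : Continuous κt := by simp only [hκt]; fun_prop
      simp only [hκs]
      fun_prop
    have := hc.tendsto x₀
    simpa [hκs, hκt] using this
  -- Subtracting the conic's equation at `φ s` from that at `t` leaves `t - φ s` times this factor.
  -- It is close to `-2`, so near `x₀` the conic has no branch other than the graph.
  have hfactor : ∀ᶠ z : ℝ × ℝ in 𝓝 (0, 0), 2 * q * z.1 + r * (z.2 + φ z.1) - 2 ≠ 0 := by
    have hc : Tendsto (fun z : ℝ × ℝ => 2 * q * z.1 + r * (z.2 + φ z.1) - 2) (𝓝 (0, 0))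
        (𝓝 (2 * q * 0 + r * (0 + 0) - 2)) := by
      have h1 : Tendsto (fun z : ℝ × ℝ => z.1) (𝓝 (0, 0)) (𝓝 0) := continuous_fst.tendsto _
      have h2 : Tendsto (fun z : ℝ × ℝ => z.2) (𝓝 (0, 0)) (𝓝 0) := continuous_snd.tendsto _
      exact (((h1.const_mul (2 * q)).add ((h2.add (hφc.comp h1)).const_mul r))).sub_const 2
    exact hc.eventually_ne (by norm_num)
  have hquad' : ∀ᶠ z : ℝ × ℝ in 𝓝 (0, 0),
      p * z.1 ^ 2 + 2 * q * z.1 * φ z.1 + r * φ z.1 ^ 2 - 2 * φ z.1 = 0 :=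
    (continuous_fst.tendsto ((0 : ℝ), (0 : ℝ))).eventually hquad
  have hcoord : ∀ x ∈ P, ∃ s t : ℝ, x = x₀ + s • e + t • v := fun x hx => by
    obtain ⟨s, t, h⟩ := hbas _ (AffineSubspace.vsub_mem_direction hx htr.1)
    exact ⟨s, t, by rw [add_assoc, ← h, vsub_eq_sub, add_sub_cancel]⟩
  have hiff : ∀ᶠ x in 𝓝 x₀, x ∈ α.planeSection P ↔ x ∈ C := by
    filter_upwards [hκlim.eventually hφ, hκlim.eventually hfactor, hκlim.eventually hquad']
      with x h1 h2 h3
    constructor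
    · rintro ⟨hxc, hxP⟩
      obtain ⟨s, t, rfl⟩ := hcoord x hxP
      simp only [hκ] at h1 h2 h3
      rw [h1.1 hxc] at h3
      exact ⟨s, t, rfl, h3⟩
    · rintro ⟨s, t, rfl, hst⟩
      simp only [hκ] at h1 h2 h3
      have h4 : (t - φ s) * (2 * q * s + r * (t + φ s) - 2) = 0 := by linear_combination hst - h3
      have h5 : φ s = t := (sub_eq_zero.1 ((mul_eq_zero.1 h4).resolve_right h2)).symm
      exact ⟨h1.2 h5, h5 ▸ hAP s⟩
  refine ⟨⟨C, hconic, hiff⟩, ?_⟩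
  have hgood : ∀ᶠ s in 𝓝 0, ∀ k : ℕ, k ≤ 5 →
      HasContactGT k (α.planeSection P) C (A s) := by
    filter_upwards [hφ6.eventually (by simp), dA, eventually_eventually_nhds.2 hAC,
      eventually_eventually_nhds.2 (hAt.eventually hiff)] with s hs hsd hsC hsi k hk
    have hsh : Tendsto (fun t : ℝ => s + t) (𝓝 0) (𝓝 s) := by
      have : Continuous fun t : ℝ => s + t := by fun_prop
      simpa using this.tendsto 0
    -- The section lies in the conic near this point, so one parametrization serves for both curves.
    refine HasContactGT.of_eventually_mem (γ := fun t => A (s + t)) ?_ (by simp) ?_ ?_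
    · have hφk : ContDiffAt ℝ k φ (s + 0) := by
        rw [add_zero]
        exact hs.of_le (by exact_mod_cast hk.trans (by norm_num))
      have hφk' : ContDiffAt ℝ k (fun t => φ (s + t)) 0 :=
        hφk.comp (0 : ℝ) (contDiffAt_const.add contDiffAt_id)
      exact (contDiffAt_const.add ((contDiffAt_const.add contDiffAt_id).smul
        contDiffAt_const)).add (hφk'.smul contDiffAt_const)
    · have h1 : HasDerivAt A (e + deriv φ s • v) (s + 0) := by rwa [add_zero]
      rw [(h1.comp_const_add s 0).deriv]
      exact hve0 _
    · filter_upwards [hsh.eventually hsC, hsh.eventually hsi] with t ht hti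
      have : A (s + t) ∈ α.planeSection P := ⟨ht, hAP _⟩
      exact ⟨this, hti.1 this⟩
  have hκs0 : Tendsto κs (𝓝 x₀) (𝓝 0) := (continuous_fst.tendsto ((0 : ℝ), (0 : ℝ))).comp hκlim
  filter_upwards [hκlim.eventually hφ, hκs0.eventually hgood] with O h1 h2 hO
  obtain ⟨s, t, rfl⟩ := hcoord O hO.2
  simp only [hκ] at h1 h2
  have hst := h1.1 hO.1
  subst hst
  exact ⟨C, ⟨hconic, h2 4 (by norm_num)⟩, h2 5 le_rfl⟩
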